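/- Let $m$ and $n$ be positive integers, and let $m=\prod_{i=1}^s p_i^{\alpha_i}$, where $3\le p_1<p_2<\cdots<p_s$ are odd primes and the $\alpha_i$ are positive integers. Write $\mathbb{Z}_k$ for the integers modulo $k$, and put $\zeta_m=e^{2\pi\sqrt{-1}/m}$. A function $f:\mathbb{Z}_2^n\to\mathbb{Z}_m$ is called an $(m,n)$-generalized bent function if $$\Bigl|\sum_{x\in\mathbb{Z}_2^n}\zeta_m^{f(x)}(-1)^{y\cdot x}\Bigr|^2=2^n\qquad\text{for all } y\in\mathbb{Z}_2^n,$$ where $y\cdot x=\sum_{i=1}^n y_ix_i$. If an $(m,n)$-generalized bent function exists, then $s\ge 2$ and $3p_1+p_2\le 2^n$. -/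

import Mathlib

/-- The transform `F(y) = ∑_{x ∈ ℤ₂ⁿ} ζ_m ^ f(x) * (-1) ^ (y · x)` of a function `f : ℤ₂ⁿ → ℤ_m`,
where `ζ_m = exp (2πi / m)`. Exponents are taken through the standard representatives
`ZMod.val`; this is the usual meaning because `ζ_m ^ m = 1` and `(-1) ^ 2 = 1`. -/
noncomputable def gbfTransform (m n : ℕ) (f : (Fin n → ZMod 2) → ZMod m) (y : Fin n → ZMod 2) : ℂ :=
  ∑ x : Fin n → ZMod 2,
    Complex.exp (2 * Real.pi * Complex.I / m) ^ (f x).val * (-1 : ℂ) ^ (y ⬝ᵥ x).val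

/-- `f : ℤ₂ⁿ → ℤ_m` is an `(m, n)`-generalized bent function: `|F(y)|² = 2ⁿ` for all `y ∈ ℤ₂ⁿ`. -/
def IsGeneralizedBent (m n : ℕ) (f : (Fin n → ZMod 2) → ZMod m) : Prop :=
  ∀ y : Fin n → ZMod 2, ‖gbfTransform m n f y‖ ^ 2 = (2 : ℝ) ^ n

/-! Fourier inversion turns bentness into vanishing autocorrelations: for each `w ≠ 0` the `2 ^ n`
quotients `g x / g (x + w)`, with `g x = ζ ^ f x`, are `m`-th roots of unity with sum zero. Write
`a`, `b` for the two smallest primes and suppose `2 ^ n < 3 * a + b`. By `isGonSum_of_sum_eq_zero`,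
so short a vanishing sum is a union of regular polygons with prime numbers of vertices; it rests on
`mul_le_card_of_sum_eq`, which bounds the length of a second expression for a short sum. Parity and
size leave exactly two polygons, a `q`-gon and a `q'`-gon with `q ≠ q'`
(`IsGonSum.exists_two_gons`). Exchanging `x` and `x + w` inverts the quotients, so both polygons
pass through 1 (`pow_eq_one_of_inv_mem`). Hence any two values of `g` have a quotient of order 1 or
a prime. One quotient of order `q` then forces all quotients to have order dividing `q`, although
order `q'` occurs too. -/

/-! ### Linear relations over cyclotomic fields -/

-- Degree count: `ℚ(ζ)` lies in the top of the tower `ℚ ⊆ ℚ(ξ) ⊆ ℚ(ξ)(ω)`.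
open IntermediateField in
theorem totient_mul_le_natDegree_minpoly {m k : ℕ} (hm : 0 < m) (hk : 0 < k) {ξ ω ζ : ℂ}
    (hξ : IsPrimitiveRoot ξ k) (hζ : IsPrimitiveRoot ζ m) {j : ℕ} (hj : 0 < j) (hω : ω ^ j = 1)
    (h : ζ ∈ (ℚ⟮ξ⟯)⟮ω⟯) :
    m.totient ≤ k.totient * (minpoly ℚ⟮ξ⟯ ω).natDegree := by
  have hωi : IsIntegral ℚ⟮ξ⟯ ω := by
    refine ⟨Polynomial.X ^ j - 1, Polynomial.monic_X_pow_sub_C 1 hj.ne', ?_⟩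
    simp [hω]
  have hfin {ρ : ℂ} {l : ℕ} (hl : 0 < l) (hρ : IsPrimitiveRoot ρ l) :
      Module.finrank ℚ ℚ⟮ρ⟯ = l.totient := by
    rw [adjoin.finrank (hρ.isIntegral hl).tower_top,
      ← Polynomial.cyclotomic_eq_minpoly_rat hρ hl, Polynomial.natDegree_cyclotomic]
  have e1 := hfin hk hξ
  have e2 := hfin hm hζ
  have e3 := adjoin.finrank hωi
  have : FiniteDimensional ℚ ℚ⟮ξ⟯ := adjoin.finiteDimensional (hξ.isIntegral hk).tower_top
  have : FiniteDimensional ℚ⟮ξ⟯ (ℚ⟮ξ⟯)⟮ω⟯ := adjoin.finiteDimensional hωi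
  have e4 := Module.finrank_mul_finrank ℚ ℚ⟮ξ⟯ (ℚ⟮ξ⟯)⟮ω⟯
  rw [e1, e3] at e4
  rw [e4, ← e2]
  have : FiniteDimensional ℚ (ℚ⟮ξ⟯)⟮ω⟯ := Module.Finite.trans ℚ⟮ξ⟯ _
  have hle : ℚ⟮ζ⟯ ≤ ((ℚ⟮ξ⟯)⟮ω⟯).restrictScalars ℚ := by
    rw [adjoin_simple_le_iff]
    exact h
  exact LinearMap.finrank_le_finrank_of_injective (f := (inclusion hle).toLinearMap)
    (inclusion hle).injective

theorem eq_zero_of_sum_pow_mul_eq_zero {K : IntermediateField ℚ ℂ} {ω : ℂ} {d : ℕ}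
    (hd : d ≤ (minpoly K ω).natDegree) {β : ℕ → ℂ} (hβ : ∀ r, β r ∈ K)
    (h : ∑ r ∈ Finset.range d, ω ^ r * β r = 0) : ∀ r < d, β r = 0 := by
  have hl := (linearIndependent_pow (K := K) ω).comp (Fin.castLE hd) (Fin.castLE_injective hd)
  rw [Fintype.linearIndependent_iff] at hl
  intro r hr
  have := hl (fun i => ⟨β i, hβ i⟩) (by
    rw [← h, Finset.sum_range]
    refine Finset.sum_congr rfl fun i _ => ?_
    simp [IntermediateField.smul_def, mul_comm]) ⟨r, hr⟩
  simpa using congrArg Subtype.val this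

-- When `p ∣ k`, `φ(p * k) = p * φ(k)`, so `ω` has degree at least `p` over `ℚ(ω ^ p)` and its first
-- `p` powers are independent.
open IntermediateField in
theorem eq_zero_of_sum_pow_mul_eq_zero_of_dvd {k p : ℕ} (hk : 0 < k) (hp : p.Prime) (hpk : p ∣ k)
    {ω : ℂ} (hω : IsPrimitiveRoot ω (p * k)) {β : ℕ → ℂ} (hβ : ∀ r, β r ∈ ℚ⟮ω ^ p⟯)
    (h : ∑ r ∈ Finset.range p, ω ^ r * β r = 0) : ∀ r < p, β r = 0 := by
  refine eq_zero_of_sum_pow_mul_eq_zero ?_ hβ h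
  have hpk0 : 0 < p * k := Nat.mul_pos hp.pos hk
  have h1 := totient_mul_le_natDegree_minpoly hpk0 hk (hω.pow hpk0 rfl) hω hpk0 hω.pow_eq_one
    (mem_adjoin_simple_self _ _)
  rw [Nat.totient_mul_of_prime_of_dvd hp hpk, mul_comm] at h1
  exact Nat.le_of_mul_le_mul_left h1 (Nat.totient_pos.2 hk)

-- Here the degree bound is only `p - 1`: the relation `1 + ω + ⋯ + ω ^ (p - 1) = 0` survives.
-- Subtracting `β (p - 1)` times it removes the last term and leaves independent powers.
open IntermediateField in
theorem eq_of_sum_pow_mul_eq_zero_of_coprime {k p : ℕ} (hk : 0 < k) (hp : p.Prime)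
    (hpk : ¬ p ∣ k) {ω ξ : ℂ} (hω : IsPrimitiveRoot ω p) (hξ : IsPrimitiveRoot ξ k)
    {β : ℕ → ℂ} (hβ : ∀ r, β r ∈ ℚ⟮ξ⟯)
    (h : ∑ r ∈ Finset.range p, ω ^ r * β r = 0) : ∀ r < p, β r = β (p - 1) := by
  have hcop : Nat.Coprime p k := (Nat.Prime.coprime_iff_not_dvd hp).2 hpk
  have hpk0 : 0 < p * k := Nat.mul_pos hp.pos hk
  have hζ : IsPrimitiveRoot (ω * ξ) (p * k) := by
    have := (Commute.all ω ξ).orderOf_mul_eq_mul_orderOf_of_coprime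
      (by rwa [← hω.eq_orderOf, ← hξ.eq_orderOf])
    rw [← hω.eq_orderOf, ← hξ.eq_orderOf] at this
    rw [← this]
    exact IsPrimitiveRoot.orderOf _
  have h1 := totient_mul_le_natDegree_minpoly hpk0 hk hξ hζ hp.pos hω.pow_eq_one
    (mul_mem (mem_adjoin_simple_self _ _)
      (IntermediateField.algebraMap_mem (ℚ⟮ξ⟯)⟮ω⟯ (⟨ξ, mem_adjoin_simple_self _ _⟩ : ℚ⟮ξ⟯)))
  rw [Nat.totient_mul hcop, mul_comm, Nat.totient_prime hp] at h1
  have h2 := Nat.le_of_mul_le_mul_left h1 (Nat.totient_pos.2 hk)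
  have h3 := eq_zero_of_sum_pow_mul_eq_zero h2 (β := fun r => β r - β (p - 1))
    (fun r => sub_mem (hβ _) (hβ _)) (by
      have hg := hω.geom_sum_eq_zero hp.one_lt
      have : ∑ r ∈ Finset.range p, ω ^ r * (β r - β (p - 1)) = 0 := by
        simp only [mul_sub, Finset.sum_sub_distrib, h, ← Finset.sum_mul, hg]
        simp
      rw [← Nat.sub_add_cancel hp.one_le, Finset.sum_range_succ] at this
      simpa using this)
  intro r hr
  rcases Nat.lt_or_ge r (p - 1) with h' | h'
  · exact sub_eq_zero.1 (h3 r h')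
  · rw [show r = p - 1 by omega]

/-! ### Splitting roots of unity into cosets -/

open Classical in
/-- The part of `x` in the coset of `k`-th roots of unity through `ω ^ r`, divided by `ω ^ r`. -/
noncomputable def cosetPart (ω : ℂ) (k r : ℕ) (x : Multiset ℂ) : Multiset ℂ :=
  (x.filter fun z => z ^ k = (ω ^ k) ^ r).map fun z => z / ω ^ r

theorem pow_eq_one_of_mem_cosetPart {ω : ℂ} (hω : ω ≠ 0) {k r : ℕ} {x : Multiset ℂ} {u : ℂ}
    (hu : u ∈ cosetPart ω k r x) : u ^ k = 1 := by
  simp only [cosetPart, Multiset.mem_map, Multiset.mem_filter] at hu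
  obtain ⟨z, ⟨-, hz⟩, rfl⟩ := hu
  rw [div_pow, hz, ← pow_mul, ← pow_mul, mul_comm]
  exact div_self (pow_ne_zero _ hω)

theorem sum_cosetPart {ω : ℂ} {k p : ℕ} (hp : 0 < p) (hω0 : ω ≠ 0)
    (hω : IsPrimitiveRoot (ω ^ k) p)
    {x : Multiset ℂ} (hx : ∀ z ∈ x, z ^ (p * k) = 1) :
    ∑ r ∈ Finset.range p, (cosetPart ω k r x).map (fun u => ω ^ r * u) = x := by
  classical
  have h1 : ∀ r, (cosetPart ω k r x).map (fun u => ω ^ r * u) =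
      x.filter fun z => z ^ k = (ω ^ k) ^ r := by
    intro r
    rw [cosetPart, Multiset.map_map]
    conv_rhs => rw [← Multiset.map_id (x.filter fun z => z ^ k = (ω ^ k) ^ r)]
    refine Multiset.map_congr (by congr) fun z _ => ?_
    simp only [Function.comp_apply, id]
    field_simp
  simp only [h1]
  clear h1
  induction x using Multiset.induction with
  | empty => simp
  | cons z x ih =>
    have : NeZero p := ⟨hp.ne'⟩
    obtain ⟨i, hi, hiz⟩ := hω.eq_pow_of_pow_eq_one (ξ := z ^ k)
      (by rw [← pow_mul, mul_comm]; exact hx z (by simp))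
    simp only [Multiset.filter_cons, Finset.sum_add_distrib]
    rw [ih fun w hw => hx w (Multiset.mem_cons_of_mem hw),
      Finset.sum_eq_single_of_mem i (Finset.mem_range.2 hi)]
    · simp [hiz]
    · intro j hj hji
      rw [if_neg]
      rw [← hiz]
      exact fun h => hji (hω.pow_inj (Finset.mem_range.1 hj) hi h.symm)

theorem sum_card_cosetPart {ω : ℂ} {k p : ℕ} (hp : 0 < p) (hω0 : ω ≠ 0)
    (hω : IsPrimitiveRoot (ω ^ k) p)
    {x : Multiset ℂ} (hx : ∀ z ∈ x, z ^ (p * k) = 1) :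
    ∑ r ∈ Finset.range p, (cosetPart ω k r x).card = x.card := by
  conv_rhs => rw [← sum_cosetPart hp hω0 hω hx]
  simp

theorem sum_pow_mul_sum_cosetPart {ω : ℂ} {k p : ℕ} (hp : 0 < p) (hω0 : ω ≠ 0)
    (hω : IsPrimitiveRoot (ω ^ k) p)
    {x : Multiset ℂ} (hx : ∀ z ∈ x, z ^ (p * k) = 1) :
    ∑ r ∈ Finset.range p, ω ^ r * (cosetPart ω k r x).sum = x.sum := by
  conv_rhs => rw [← sum_cosetPart hp hω0 hω hx]
  rw [Multiset.sum_sum]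
  exact Finset.sum_congr rfl fun r _ => by rw [Multiset.sum_map_mul_left, Multiset.map_id']

theorem exists_not_cosetPart_le {ω : ℂ} {k p : ℕ} (hp : 0 < p) (hω0 : ω ≠ 0)
    (hω : IsPrimitiveRoot (ω ^ k) p)
    {x y : Multiset ℂ} (hx : ∀ z ∈ x, z ^ (p * k) = 1) (hy : ∀ z ∈ y, z ^ (p * k) = 1)
    (h : ¬ x ≤ y) : ∃ r < p, ¬ cosetPart ω k r x ≤ cosetPart ω k r y := by
  by_contra! hcon
  apply h
  rw [← sum_cosetPart hp hω0 hω hx, ← sum_cosetPart hp hω0 hω hy]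
  exact Finset.sum_le_sum fun r hr => Multiset.map_le_map (hcon r (Finset.mem_range.1 hr))

open IntermediateField in
theorem sum_mem_adjoin_of_pow_eq_one {ξ : ℂ} {k : ℕ} (hk : 0 < k) (hξ : IsPrimitiveRoot ξ k)
    {x : Multiset ℂ} (hx : ∀ z ∈ x, z ^ k = 1) : x.sum ∈ ℚ⟮ξ⟯ := by
  have : NeZero k := ⟨hk.ne'⟩
  refine multiset_sum_mem _ fun z hz => ?_
  obtain ⟨i, -, rfl⟩ := hξ.eq_pow_of_pow_eq_one (hx z hz)
  exact pow_mem (mem_adjoin_simple_self _ _) _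

/-- The primitive root used to split the `p * k`-th roots of unity into cosets of the `k`-th
roots of unity. -/
noncomputable def cosetRoot (p k : ℕ) : ℂ :=
  if p ∣ k then Complex.exp (2 * Real.pi * Complex.I / (p * k : ℕ))
  else Complex.exp (2 * Real.pi * Complex.I / p)

theorem cosetRoot_ne_zero (p k : ℕ) : cosetRoot p k ≠ 0 := by
  unfold cosetRoot
  split_ifs <;> exact Complex.exp_ne_zero _

theorem cosetRoot_pow_isPrimitiveRoot {p k : ℕ} (hk : 0 < k) (hp : p.Prime) :
    IsPrimitiveRoot (cosetRoot p k ^ k) p := by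
  unfold cosetRoot
  split_ifs with h
  · exact (Complex.isPrimitiveRoot_exp (p * k) (Nat.mul_pos hp.pos hk).ne').pow
      (Nat.mul_pos hp.pos hk) (mul_comm _ _)
  · exact (Complex.isPrimitiveRoot_exp p hp.ne_zero).pow_of_coprime k
      ((Nat.Prime.coprime_iff_not_dvd hp).2 h).symm

theorem sum_cosetPart_eq_of_dvd {p k : ℕ} (hk : 0 < k) (hp : p.Prime) (hpk : p ∣ k)
    {x y : Multiset ℂ} (hx : ∀ z ∈ x, z ^ (p * k) = 1) (hy : ∀ z ∈ y, z ^ (p * k) = 1)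
    (h : x.sum = y.sum) {r : ℕ} (hr : r < p) :
    (cosetPart (cosetRoot p k) k r x).sum = (cosetPart (cosetRoot p k) k r y).sum := by
  have hω0 := cosetRoot_ne_zero p k
  have hω := cosetRoot_pow_isPrimitiveRoot hk hp
  have h0 := Nat.mul_pos hp.pos hk
  have hprim : IsPrimitiveRoot (cosetRoot p k) (p * k) := by
    rw [cosetRoot, if_pos hpk]
    exact Complex.isPrimitiveRoot_exp (p * k) h0.ne'
  refine sub_eq_zero.1 (eq_zero_of_sum_pow_mul_eq_zero_of_dvd hk hp hpk hprim
    (β := fun r => (cosetPart (cosetRoot p k) k r x).sum - (cosetPart (cosetRoot p k) k r y).sum)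
    (fun r => sub_mem ?_ ?_) ?_ r hr)
  · exact sum_mem_adjoin_of_pow_eq_one hk (hprim.pow h0 rfl)
      fun z hz => pow_eq_one_of_mem_cosetPart hω0 hz
  · exact sum_mem_adjoin_of_pow_eq_one hk (hprim.pow h0 rfl)
      fun z hz => pow_eq_one_of_mem_cosetPart hω0 hz
  · simp only [mul_sub, Finset.sum_sub_distrib]
    rw [sum_pow_mul_sum_cosetPart hp.pos hω0 hω hx, sum_pow_mul_sum_cosetPart hp.pos hω0 hω hy, h,
      sub_self]

theorem sum_cosetPart_add_eq_of_not_dvd {p k : ℕ} (hk : 0 < k) (hp : p.Prime) (hpk : ¬ p ∣ k)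
    {x y : Multiset ℂ} (hx : ∀ z ∈ x, z ^ (p * k) = 1) (hy : ∀ z ∈ y, z ^ (p * k) = 1)
    (h : x.sum = y.sum) {r t : ℕ} (hr : r < p) (ht : t < p) :
    (cosetPart (cosetRoot p k) k r x).sum + (cosetPart (cosetRoot p k) k t y).sum =
      (cosetPart (cosetRoot p k) k t x).sum + (cosetPart (cosetRoot p k) k r y).sum := by
  have hω0 := cosetRoot_ne_zero p k
  have hω := cosetRoot_pow_isPrimitiveRoot hk hp
  have hprim : IsPrimitiveRoot (cosetRoot p k) p := by
    rw [cosetRoot, if_neg hpk]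
    exact Complex.isPrimitiveRoot_exp p hp.ne_zero
  have hξ := Complex.isPrimitiveRoot_exp k hk.ne'
  have key := eq_of_sum_pow_mul_eq_zero_of_coprime hk hp hpk hprim hξ
    (β := fun r => (cosetPart (cosetRoot p k) k r x).sum - (cosetPart (cosetRoot p k) k r y).sum)
    (fun r => sub_mem
      (sum_mem_adjoin_of_pow_eq_one hk hξ fun z hz => pow_eq_one_of_mem_cosetPart hω0 hz)
      (sum_mem_adjoin_of_pow_eq_one hk hξ fun z hz => pow_eq_one_of_mem_cosetPart hω0 hz))
    (by
      simp only [mul_sub, Finset.sum_sub_distrib]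
      rw [sum_pow_mul_sum_cosetPart hp.pos hω0 hω hx,
        sum_pow_mul_sum_cosetPart hp.pos hω0 hω hy, h, sub_self])
  have := (key r hr).trans (key t ht).symm
  linear_combination this

/-! ### Second expressions for a short sum -/

/-- The right side minus the left is `(x - (c + u - 1)) * (b - 1) + (u - 1) * (b - 1 - l)`. -/
theorem mul_le_mul_add_mul_of_lt {a b c l u x : ℕ} (hab : a < b) (hu : 0 < u)
    (hx : c + (u - 1) ≤ x) (hxa : x < a) (h : c + l < a) :
    (a - x) * (b - 1) ≤ (a - (c + l)) * (b - 1) + (b - u) * l := by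
  zify [show u ≤ b by omega, hxa.le, show 1 ≤ b by omega, h.le]
  have e1 : (c : ℤ) + (u - 1) ≤ x := by omega
  have e2 : (0 : ℤ) ≤ (b : ℤ) - 1 := by omega
  have e3 : (0 : ℤ) ≤ (u - 1) * ((b : ℤ) - 1 - l) := mul_nonneg (by omega) (by omega)
  linear_combination mul_nonneg (sub_nonneg.2 e1) e2 + e3

theorem mul_le_mul_of_le_add {a b c l u x : ℕ} (hab : a < b) (hu : 0 < u) (hc : 0 < c)
    (hx : c + (u - 1) ≤ x) (hxa : x < a) (h : a ≤ c + l) :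
    (a - x) * (b - 1) ≤ (b - u) * l := by
  zify [show u ≤ b by omega, hxa.le, show 1 ≤ b by omega]
  have e2 : (a : ℤ) - x + (u - 1) ≤ l := by omega
  have e3 : (0 : ℤ) ≤ (b : ℤ) - u := by omega
  have e4 : (0 : ℤ) ≤ (u - 1) * ((b : ℤ) - u - (a - x)) := mul_nonneg (by omega) (by omega)
  linear_combination mul_nonneg (sub_nonneg.2 e2) e3 + e4

/-- A lower bound for the length of a sum of roots of unity of order `m` that equals a shorter sum
`x` without containing it; every prime factor of `m` is `a` or at least `b`. -/
theorem mul_le_card_of_sum_eq {a b : ℕ} (hab : a < b) (m : ℕ) (hm : 0 < m)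
    (hq : ∀ q : ℕ, q.Prime → q ∣ m → q = a ∨ b ≤ q) (x y : Multiset ℂ)
    (hx : ∀ z ∈ x, z ^ m = 1) (hy : ∀ z ∈ y, z ^ m = 1) (hxa : x.card < a)
    (h : x.sum = y.sum) (hxy : ¬ x ≤ y) : (a - x.card) * (b - 1) ≤ y.card := by
  induction m using Nat.strong_induction_on generalizing x y with
  | _ m ih =>
  have hone : ∀ {x y : Multiset ℂ}, (∀ z ∈ x, z ^ 1 = 1) → (∀ z ∈ y, z ^ 1 = 1) →
      x.sum = y.sum → x ≤ y := by
    intro x y hx hy h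
    rw [Multiset.eq_replicate_of_mem (fun z hz => by simpa using hx z hz : ∀ z ∈ x, z = 1),
      Multiset.eq_replicate_of_mem (fun z hz => by simpa using hy z hz : ∀ z ∈ y, z = 1)] at h ⊢
    simp only [Multiset.sum_replicate, nsmul_eq_mul, mul_one, Nat.cast_inj] at h
    rw [h]
  rcases Nat.eq_or_lt_of_le (Nat.succ_le_of_lt hm) with rfl | hm1
  · exact absurd (hone hx hy h) hxy
  -- Split off a prime at least `b` if there is one; otherwise `m` is a power of `a`.
  obtain ⟨p, hp, hpm, hpb⟩ : ∃ p : ℕ, p.Prime ∧ p ∣ m ∧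
      (b ≤ p ∨ p = a ∧ ∀ q : ℕ, q.Prime → q ∣ m → q = a) := by
    by_cases hb : ∃ q : ℕ, q.Prime ∧ q ∣ m ∧ b ≤ q
    · obtain ⟨q, h1, h2, h3⟩ := hb
      exact ⟨q, h1, h2, Or.inl h3⟩
    · have hb' : ∀ q : ℕ, q.Prime → q ∣ m → q = a := fun q h1 h2 =>
        (hq q h1 h2).resolve_right fun h3 => hb ⟨q, h1, h2, h3⟩
      have h1 := Nat.minFac_prime hm1.ne'
      exact ⟨m.minFac, h1, m.minFac_dvd, Or.inr ⟨hb' _ h1 m.minFac_dvd, hb'⟩⟩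
  obtain ⟨k, rfl⟩ := hpm
  have hk : 0 < k := Nat.pos_of_mul_pos_left hm
  have hkm : k < p * k := lt_mul_of_one_lt_left hk hp.one_lt
  have hω0 := cosetRoot_ne_zero p k
  have hω := cosetRoot_pow_isPrimitiveRoot hk hp
  obtain ⟨r, hr, hrxy⟩ := exists_not_cosetPart_le hp.pos hω0 hω hx hy hxy
  have hqk : ∀ q : ℕ, q.Prime → q ∣ k → q = a ∨ b ≤ q := fun q h1 h2 =>
    hq q h1 (h2.mul_left p)
  have hcx := sum_card_cosetPart hp.pos hω0 hω hx
  have hcy := sum_card_cosetPart hp.pos hω0 hω hy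
  have hrange : r ∈ Finset.range p := Finset.mem_range.2 hr
  by_cases hpk : p ∣ k
  · have hs := sum_cosetPart_eq_of_dvd hk hp hpk hx hy h hr
    have hxr : (cosetPart (cosetRoot p k) k r x).card ≤ x.card := by
      rw [← hcx]
      exact Finset.single_le_sum (f := fun r => (cosetPart (cosetRoot p k) k r x).card)
        (fun _ _ => Nat.zero_le _) hrange
    have hyr : (cosetPart (cosetRoot p k) k r y).card ≤ y.card := by
      rw [← hcy]
      exact Finset.single_le_sum (f := fun r => (cosetPart (cosetRoot p k) k r y).card)
        (fun _ _ => Nat.zero_le _) hrange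
    have := ih k hkm hk hqk _ _ (fun z hz => pow_eq_one_of_mem_cosetPart hω0 hz)
      (fun z hz => pow_eq_one_of_mem_cosetPart hω0 hz) (hxr.trans_lt hxa) hs hrxy
    calc (a - x.card) * (b - 1) ≤ (a - (cosetPart (cosetRoot p k) k r x).card) * (b - 1) :=
          Nat.mul_le_mul_right _ (by omega)
      _ ≤ _ := this.trans hyr
  have hs := fun t ht => sum_cosetPart_add_eq_of_not_dvd hk hp hpk hx hy h hr (t := t) ht
  set X : ℕ → Multiset ℂ := fun r => cosetPart (cosetRoot p k) k r x with hX
  set Y : ℕ → Multiset ℂ := fun r => cosetPart (cosetRoot p k) k r y with hY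
  have hX1 : ∀ r, ∀ z ∈ X r, z ^ k = 1 := fun r z hz => pow_eq_one_of_mem_cosetPart hω0 hz
  have hY1 : ∀ r, ∀ z ∈ Y r, z ^ k = 1 := fun r z hz => pow_eq_one_of_mem_cosetPart hω0 hz
  change ∑ r ∈ Finset.range p, (X r).card = _ at hcx
  change ∑ r ∈ Finset.range p, (Y r).card = _ at hcy
  change ∀ t < p, (X r).sum + (Y t).sum = (X t).sum + (Y r).sum at hs
  change ¬ X r ≤ Y r at hrxy
  classical
  set T := (Finset.range p).filter fun t => X t = 0 with hT
  set U := (Finset.range p).filter fun t => ¬ X t = 0 with hU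
  have hTU : T.card + U.card = p := by
    rw [hT, hU, Finset.card_filter_add_card_filter_not, Finset.card_range]
  have hrU : r ∈ U := by
    simp only [hU, Finset.mem_filter, hrange, true_and]
    exact fun h0 => hrxy (h0 ▸ Multiset.zero_le _)
  have hap : a ≤ p := by omega
  have hXU : (X r).card + (U.card - 1) ≤ x.card := by
    rw [← hcx, ← Finset.card_erase_of_mem hrU]
    calc (X r).card + (U.erase r).card
        ≤ (X r).card + ∑ t ∈ U.erase r, (X t).card := by
          rw [Finset.card_eq_sum_ones]
          gcongr with t ht
          exact Multiset.card_pos.2 (Finset.mem_filter.1 (Finset.mem_of_mem_erase ht)).2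
      _ = ∑ t ∈ U, (X t).card := Finset.add_sum_erase _ (fun t => (X t).card) hrU
      _ ≤ _ := Finset.sum_le_sum_of_subset (Finset.filter_subset _ _)
  have hXr : 0 < (X r).card := Multiset.card_pos.2 (Finset.mem_filter.1 hrU).2
  have hU1 : 0 < U.card := Finset.card_pos.2 ⟨r, hrU⟩
  have hTne : T.Nonempty := Finset.card_pos.1 (by omega)
  -- As `X t` is empty, the coset relation becomes `(X r + Y t).sum = (Y r).sum`, an instance for
  -- the smaller order `k`. Minimality of `Y t` bounds the other cosets in `T` from below.
  obtain ⟨t, htT, htmin⟩ := Finset.exists_min_image T (fun t => (Y t).card) hTne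
  have hrT : r ∉ T := fun h' => (Finset.mem_filter.1 hrU).2 (Finset.mem_filter.1 h').2
  have hYT : (Y r).card + T.card * (Y t).card ≤ y.card := by
    rw [← hcy]
    calc (Y r).card + T.card * (Y t).card
        ≤ (Y r).card + ∑ j ∈ T, (Y j).card := by
          gcongr
          simpa using Finset.card_nsmul_le_sum T (fun t => (Y t).card) _ htmin
      _ = ∑ j ∈ insert r T, (Y j).card := (Finset.sum_insert (f := fun j => (Y j).card) hrT).symm
      _ ≤ _ := Finset.sum_le_sum_of_subset
          (Finset.insert_subset hrange (Finset.filter_subset _ _))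
  have hst := hs t (Finset.mem_range.1 (Finset.mem_filter.1 htT).1)
  rw [(Finset.mem_filter.1 htT).2, Multiset.sum_zero, zero_add, ← Multiset.sum_add] at hst
  have hnle : ¬ X r + Y t ≤ Y r := fun h' => hrxy ((Multiset.le_add_right _ _).trans h')
  have hZ1 : ∀ z ∈ X r + Y t, z ^ k = 1 := fun z hz =>
    (Multiset.mem_add.1 hz).elim (hX1 r z) (hY1 t z)
  -- If `a` were the only prime, `¬ p ∣ k` would give `k = 1`, where equal sums mean equal
  -- multisets.
  have hbp : b ≤ p := by
    refine hpb.resolve_right fun ⟨hpa, hall⟩ => hnle ?_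
    obtain rfl : k = 1 := by
      by_contra hk1
      have h1 := Nat.minFac_prime hk1
      have := hall _ h1 (k.minFac_dvd.mul_left p)
      exact hpk (by rw [hpa, ← this]; exact k.minFac_dvd)
    exact hone hZ1 (hY1 r) hst
  have hTc : b - U.card ≤ T.card := by omega
  set l := (Y t).card
  set c := (X r).card
  set u := U.card
  -- If `X r + Y t` is still shorter than `a`, induction bounds `Y r`; otherwise `l` is so large
  -- that the cosets in `T` suffice.
  rcases lt_or_ge (c + l) a with hlt | hge
  · have hcard : (X r + Y t).card = c + l := Multiset.card_add _ _
    have := ih k hkm hk hqk _ _ hZ1 (hY1 r) (by rwa [hcard]) hst hnle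
    rw [hcard] at this
    refine le_trans ?_ hYT
    refine le_trans ?_ (Nat.add_le_add this (Nat.mul_le_mul_right l hTc))
    exact mul_le_mul_add_mul_of_lt hab hU1 hXU hxa hlt
  · refine le_trans ?_ hYT
    refine le_trans ?_ (Nat.add_le_add (Nat.zero_le _) (Nat.mul_le_mul_right l hTc))
    rw [zero_add]
    exact mul_le_mul_of_le_add hab hU1 hXr hXU hxa hge

/-! ### Short vanishing sums and regular polygons -/

/-- The multiset of vertices of the regular `q`-gon through `g` centred at the origin. -/
noncomputable def gon (g : ℂ) (q : ℕ) : Multiset ℂ :=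
  ∑ i ∈ Finset.range q, {g * Complex.exp (2 * Real.pi * Complex.I / q) ^ i}

theorem card_gon (g : ℂ) (q : ℕ) : (gon g q).card = q := by
  simp [gon]

theorem mem_gon {g z : ℂ} (hg : g ≠ 0) {q : ℕ} (hq : 0 < q) : z ∈ gon g q ↔ z ^ q = g ^ q := by
  have hζ := Complex.isPrimitiveRoot_exp q hq.ne'
  have : NeZero q := ⟨hq.ne'⟩
  simp only [gon, Multiset.mem_sum, Finset.mem_range, Multiset.mem_singleton]
  constructor
  · rintro ⟨i, -, rfl⟩
    rw [mul_pow, ← pow_mul, mul_comm i, pow_mul, hζ.pow_eq_one, one_pow, mul_one]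
  · intro h
    obtain ⟨i, hi, hiz⟩ := hζ.eq_pow_of_pow_eq_one (ξ := z / g)
      (by rw [div_pow, h, div_self (pow_ne_zero _ hg)])
    exact ⟨i, hi, by rw [hiz, mul_div_cancel₀ _ hg]⟩

theorem sum_gon (g : ℂ) {q : ℕ} (hq : 1 < q) : (gon g q).sum = 0 := by
  have hζ := Complex.isPrimitiveRoot_exp q (by omega)
  rw [gon, Multiset.sum_sum]
  simp only [Multiset.sum_singleton]
  rw [← Finset.mul_sum, hζ.geom_sum_eq_zero hq, mul_zero]

theorem map_mul_gon (w g : ℂ) (q : ℕ) : (gon g q).map (fun u => w * u) = gon (w * g) q := by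
  rw [gon, gon, ← Multiset.coe_mapAddMonoidHom, map_sum]
  simp [mul_assoc]

/-- `E` is the union of regular polygons whose numbers of vertices are prime factors of `m`. -/
def IsGonSum (m : ℕ) (E : Multiset ℂ) : Prop :=
  ∃ Q : Multiset (ℂ × ℕ), (∀ c ∈ Q, c.1 ≠ 0 ∧ c.2.Prime ∧ c.2 ∣ m) ∧
    E = (Q.map fun c => gon c.1 c.2).sum

theorem IsGonSum.zero (m : ℕ) : IsGonSum m 0 := ⟨0, by simp, by simp⟩

theorem isGonSum_gon {m q : ℕ} {g : ℂ} (hg : g ≠ 0) (hq : q.Prime) (hqm : q ∣ m) :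
    IsGonSum m (gon g q) := ⟨{(g, q)}, by simp [hg, hq, hqm], by simp⟩

theorem IsGonSum.add {m : ℕ} {E F : Multiset ℂ} (hE : IsGonSum m E) (hF : IsGonSum m F) :
    IsGonSum m (E + F) := by
  obtain ⟨Q, hQ, rfl⟩ := hE
  obtain ⟨R, hR, rfl⟩ := hF
  exact ⟨Q + R, fun c hc => (Multiset.mem_add.1 hc).elim (hQ c) (hR c), by simp⟩

theorem IsGonSum.sum {m : ℕ} {s : Finset ℕ} {E : ℕ → Multiset ℂ}
    (h : ∀ r ∈ s, IsGonSum m (E r)) : IsGonSum m (∑ r ∈ s, E r) :=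
  Finset.sum_induction _ _ (fun _ _ => IsGonSum.add) (IsGonSum.zero m) h

theorem IsGonSum.map_mul {k m : ℕ} (hkm : k ∣ m) {E : Multiset ℂ} {w : ℂ} (hw : w ≠ 0)
    (h : IsGonSum k E) : IsGonSum m (E.map fun u => w * u) := by
  obtain ⟨Q, hQ, rfl⟩ := h
  refine ⟨Q.map fun c => (w * c.1, c.2), ?_, ?_⟩
  · intro c hc
    obtain ⟨d, hd, rfl⟩ := Multiset.mem_map.1 hc
    exact ⟨mul_ne_zero hw (hQ d hd).1, (hQ d hd).2.1, (hQ d hd).2.2.trans hkm⟩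
  · rw [← Multiset.coe_mapAddMonoidHom, map_multiset_sum, Multiset.map_map, Multiset.map_map]
    simp [Function.comp_def, map_mul_gon]

/-- A short vanishing sum of roots of unity of odd order is a union of regular polygons. -/
theorem isGonSum_of_sum_eq_zero {a b : ℕ} (ha : 3 ≤ a) (hab : a + 2 ≤ b) (m : ℕ) (hm : Odd m)
    (hq : ∀ q : ℕ, q.Prime → q ∣ m → q = a ∨ b ≤ q) (E : Multiset ℂ)
    (hE : ∀ z ∈ E, z ^ m = 1) (hE0 : E.sum = 0) (hcard : E.card < 3 * a + b) :
    IsGonSum m E := by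
  induction m using Nat.strong_induction_on generalizing E with
  | _ m ih =>
  induction hN : E.card using Nat.strong_induction_on generalizing E with
  | _ N ihN =>
  subst hN
  rcases Nat.eq_or_lt_of_le (Nat.succ_le_of_lt hm.pos) with rfl | hm1
  · rw [Multiset.eq_replicate_of_mem (fun z hz => by simpa using hE z hz : ∀ z ∈ E, z = 1)] at hE0
    simp only [Multiset.sum_replicate, nsmul_eq_mul, mul_one, Nat.cast_eq_zero,
      Multiset.card_eq_zero] at hE0
    rw [hE0]
    exact IsGonSum.zero _
  -- Taking the largest prime ensures that, when `¬ p ∣ k`, all primes of `k` are smaller than `p`.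
  obtain ⟨p, hpmem, hpmax⟩ := Finset.exists_max_image m.primeFactors id
    ⟨m.minFac, Nat.mem_primeFactors.2
      ⟨Nat.minFac_prime hm1.ne', m.minFac_dvd, hm.pos.ne'⟩⟩
  obtain ⟨hp, hpm, -⟩ := Nat.mem_primeFactors.1 hpmem
  replace hpmax : ∀ q : ℕ, q.Prime → q ∣ m → q ≤ p := fun q h1 h2 =>
    hpmax q (Nat.mem_primeFactors.2 ⟨h1, h2, hm.pos.ne'⟩)
  have hodd : ∀ q, q ∣ m → Odd q := fun q h => hm.of_dvd_nat h
  obtain ⟨k, rfl⟩ := hpm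
  have hk : 0 < k := Nat.pos_of_mul_pos_left hm.pos
  have hkm : k < p * k := lt_mul_of_one_lt_left hk hp.one_lt
  have hkodd : Odd k := hodd k (dvd_mul_left _ _)
  have hω0 := cosetRoot_ne_zero p k
  have hω := cosetRoot_pow_isPrimitiveRoot hk hp
  have hqk : ∀ q : ℕ, q.Prime → q ∣ k → q = a ∨ b ≤ q := fun q h1 h2 =>
    hq q h1 (h2.mul_left p)
  have hcE := sum_card_cosetPart hp.pos hω0 hω hE
  have hsE := sum_cosetPart hp.pos hω0 hω hE
  have hz : ∀ r, cosetPart (cosetRoot p k) k r 0 = 0 := fun r => by simp [cosetPart]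
  have hdvd := fun h r (hr : r < p) =>
    sum_cosetPart_eq_of_dvd (p := p) (y := 0) hk hp h hE (by simp) (by simpa) hr
  have hndvd := fun h r t (hr : r < p) (ht : t < p) =>
    sum_cosetPart_add_eq_of_not_dvd (p := p) (y := 0) hk hp h hE (by simp) (by simpa) hr ht
  simp only [hz, Multiset.sum_zero, add_zero] at hdvd hndvd
  set X : ℕ → Multiset ℂ := fun r => cosetPart (cosetRoot p k) k r E with hX
  have hX1 : ∀ r, ∀ z ∈ X r, z ^ k = 1 := fun r z hz => pow_eq_one_of_mem_cosetPart hω0 hz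
  change ∑ r ∈ Finset.range p, (X r).card = _ at hcE
  change ∑ r ∈ Finset.range p, (X r).map (fun u => cosetRoot p k ^ r * u) = E at hsE
  change p ∣ k → ∀ r < p, (X r).sum = 0 at hdvd
  change ¬ p ∣ k → ∀ r t : ℕ, r < p → t < p → (X r).sum = (X t).sum at hndvd
  have hXle : ∀ r < p, (X r).card ≤ E.card := fun r hr => by
    rw [← hcE]
    exact Finset.single_le_sum (f := fun r => (X r).card)
      (fun _ _ => Nat.zero_le _) (Finset.mem_range.2 hr)
  have hzero : (∀ r < p, (X r).sum = 0) → IsGonSum (p * k) E := fun h0 => by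
    rw [← hsE]
    refine IsGonSum.sum fun r hr => ?_
    have hr := Finset.mem_range.1 hr
    exact (ih k hkm hkodd hqk _ (hX1 r) (h0 r hr) ((hXle r hr).trans_lt hcard)).map_mul
      (dvd_mul_left _ _) (pow_ne_zero _ hω0)
  by_cases hpk : p ∣ k
  · exact hzero fun r hr => hdvd hpk r hr
  obtain ⟨t, htr, htmin⟩ := Finset.exists_min_image (Finset.range p) (fun t => (X t).card)
    ⟨0, Finset.mem_range.2 hp.pos⟩
  have ht := Finset.mem_range.1 htr
  rcases Multiset.empty_or_exists_mem (X t) with h0 | ⟨u, hu⟩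
  · exact hzero fun r hr => by rw [hndvd hpk r t hr ht, h0, Multiset.sum_zero]
  have hu0 : u ≠ 0 := by
    rintro rfl
    simpa [hk.ne'] using hX1 t 0 hu
  -- A root `u` common to all cosets yields a `p`-gon to remove. Otherwise some `X r` has the sum of
  -- `X t` without containing it, which makes it too long.
  by_cases hall : ∀ r < p, X t ≤ X r
  · have hgon : gon u p ≤ E := by
      rw [← hsE, gon]
      refine Finset.sum_le_sum fun r hr => ?_
      rw [Multiset.singleton_le, Multiset.mem_map]
      refine ⟨u, Multiset.mem_of_le (hall r (Finset.mem_range.1 hr)) hu, ?_⟩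
      rw [cosetRoot, if_neg hpk, mul_comm]
    obtain ⟨F, rfl⟩ := Multiset.le_iff_exists_add.1 hgon
    rw [Multiset.card_add, card_gon] at hcard ihN
    rw [Multiset.sum_add, sum_gon _ hp.one_lt, zero_add] at hE0
    exact (isGonSum_gon hu0 hp (dvd_mul_right _ _)).add
      (ihN F.card (by have := hp.pos; omega) F
        (fun z hz => hE z (Multiset.mem_add.2 (Or.inr hz))) hE0 (by omega) rfl)
  exfalso
  push Not at hall
  obtain ⟨r, hr, hrt⟩ := hall
  have hst := hndvd hpk t r ht hr
  have hK : 0 < (X t).card := Multiset.card_pos_iff_exists_mem.2 ⟨u, hu⟩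
  have hKp : p * (X t).card ≤ E.card := by
    rw [← hcE]
    simpa using Finset.card_nsmul_le_sum (Finset.range p) (fun t => (X t).card) _ htmin
  have hKr : (p - 1) * (X t).card + (X r).card ≤ E.card := by
    rw [← hcE, ← Finset.sum_erase_add _ _ (Finset.mem_range.2 hr)]
    gcongr
    have := Finset.card_nsmul_le_sum ((Finset.range p).erase r) (fun t => (X t).card) _
      fun j hj => htmin j (Finset.mem_of_mem_erase hj)
    rwa [Finset.card_erase_of_mem (Finset.mem_range.2 hr), Finset.card_range, smul_eq_mul] at this
  have hplt : ∀ q : ℕ, q.Prime → q ∣ k → q < p := fun q h1 h2 =>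
    lt_of_le_of_ne (hpmax q h1 (h2.mul_left p)) fun h => hpk (h ▸ h2)
  have hk1 : k ≠ 1 := by
    rintro rfl
    rw [Multiset.eq_replicate_of_mem (fun z hz => by simpa using hX1 t z hz : ∀ z ∈ X t, z = 1),
      Multiset.eq_replicate_of_mem (fun z hz => by simpa using hX1 r z hz : ∀ z ∈ X r, z = 1)]
      at hst hrt
    simp only [Multiset.sum_replicate, nsmul_eq_mul, mul_one, Nat.cast_inj] at hst
    exact hrt (by rw [hst])
  have hbp : b ≤ p := by
    refine (hq p hp (dvd_mul_right _ _)).resolve_left ?_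
    rintro rfl
    have h1 := Nat.minFac_prime hk1
    have h2 := hplt _ h1 k.minFac_dvd
    have := hqk _ h1 k.minFac_dvd
    omega
  have hKa : (X t).card < a := by
    by_contra! hcon
    have := Nat.mul_le_mul hbp hcon
    nlinarith
  by_cases hex : ∃ q : ℕ, q.Prime ∧ q ∣ k ∧ b ≤ q
  · obtain ⟨q, h1, h2, h3⟩ := hex
    have hqp := hplt q h1 h2
    -- Both primes are odd, so `p` exceeds `q ≥ b` by at least 2. The total is then at least `a * (b
    -- - 1) + 2`, already `3 * a + b` or more.
    have hp2 : b + 2 ≤ p := by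
      obtain ⟨i, hi⟩ := hodd p (dvd_mul_right _ _)
      obtain ⟨j, hj⟩ := hodd q (h2.mul_left p)
      omega
    have hL := mul_le_card_of_sum_eq (by omega : a < b) k hk hqk _ _ (hX1 t) (hX1 r) hKa hst hrt
    zify [hKa.le, show 1 ≤ b by omega] at hL
    zify [hp.one_le] at hKr hcard
    have e1 : ((b : ℤ) + 1) * (X t).card ≤ (p - 1) * (X t).card := by gcongr; omega
    have e2 : (0 : ℤ) ≤ (a - 3) * (b - 5) := mul_nonneg (by omega) (by omega)
    have e3 : (1 : ℤ) ≤ (X t).card := by omega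
    have e4 : (5 : ℤ) ≤ b := by omega
    have e5 : (3 : ℤ) ≤ a := by omega
    linarith
  -- Only `a` divides `k`, so the second parameter is free; this value makes the lower bound exceed
  -- `(X r).card`.
  · have hL := mul_le_card_of_sum_eq (b := a + (X r).card + 2) (by omega) k hk
      (fun q h1 h2 => Or.inl ((hqk q h1 h2).resolve_right fun h3 => hex ⟨q, h1, h2, h3⟩))
      _ _ (hX1 t) (hX1 r) hKa hst hrt
    have := Nat.mul_le_mul_right (a + (X r).card + 2 - 1) (show 1 ≤ a - (X t).card by omega)
    omega

/-! ### Fourier inversion on `ℤ₂ⁿ` -/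

theorem neg_one_pow_val_add (a b : ZMod 2) :
    (-1 : ℂ) ^ (a + b).val = (-1) ^ a.val * (-1) ^ b.val := by
  rw [← pow_add, ZMod.val_add, neg_one_pow_eq_pow_mod_two (a.val + b.val)]

theorem sum_neg_one_pow_dotProduct_eq_zero {n : ℕ} {w : Fin n → ZMod 2} (hw : w ≠ 0) :
    ∑ y : Fin n → ZMod 2, (-1 : ℂ) ^ (y ⬝ᵥ w).val = 0 := by
  obtain ⟨i, hi⟩ := Function.ne_iff.1 hw
  have hi1 : w i = 1 := by
    have h : ∀ a : ZMod 2, a ≠ 0 → a = 1 := by decide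
    exact h _ hi
  -- Translation by a unit vector with `w i = 1` negates every term.
  have h := Fintype.sum_equiv (Equiv.addRight (Pi.single i (1 : ZMod 2)))
    (fun y : Fin n → ZMod 2 => -(-1 : ℂ) ^ (y ⬝ᵥ w).val)
    (fun y : Fin n → ZMod 2 => (-1 : ℂ) ^ (y ⬝ᵥ w).val) (by
      intro y
      simp only [Equiv.coe_addRight, add_dotProduct, single_dotProduct, one_mul,
        neg_one_pow_val_add, hi1]
      simp [ZMod.val_one])
  rw [Finset.sum_neg_distrib] at h
  linear_combination (-1 / 2 : ℂ) * h

theorem add_self_eq_zero_of_zmod_two {n : ℕ} (x : Fin n → ZMod 2) : x + x = 0 := by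
  funext i
  exact CharTwo.add_self_eq_zero _

/-- Inversion of the power spectrum: a function on `ℤ₂ⁿ` whose transform has constant modulus has
vanishing autocorrelations. -/
theorem autocorrelation_eq_zero {n : ℕ} (g : (Fin n → ZMod 2) → ℂ)
    (hg : ∀ y, ‖∑ x, g x * (-1 : ℂ) ^ (y ⬝ᵥ x).val‖ ^ 2 = (2 : ℝ) ^ n)
    {w : Fin n → ZMod 2} (hw : w ≠ 0) :
    ∑ x, g x * (starRingEnd ℂ) (g (x + w)) = 0 := by
  have h1 : ∀ y : Fin n → ZMod 2,
      ∑ x, ∑ x', g x * (starRingEnd ℂ) (g x') * (-1 : ℂ) ^ (y ⬝ᵥ (x + x')).val = 2 ^ n := by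
    intro y
    have h2 := congrArg (fun r : ℝ => (r : ℂ)) (hg y)
    simp only [Complex.ofReal_pow, ← Complex.mul_conj', map_sum, map_mul, map_pow, map_neg,
      map_one, Complex.ofReal_ofNat] at h2
    rw [← h2, Finset.sum_mul_sum]
    refine Finset.sum_congr rfl fun x _ => Finset.sum_congr rfl fun x' _ => ?_
    rw [dotProduct_add, neg_one_pow_val_add]
    ring
  have h3 : ∑ y : Fin n → ZMod 2, (-1 : ℂ) ^ (y ⬝ᵥ w).val *
      ∑ x, ∑ x', g x * (starRingEnd ℂ) (g x') * (-1 : ℂ) ^ (y ⬝ᵥ (x + x')).val = 0 := by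
    simp only [h1]
    rw [← Finset.sum_mul, sum_neg_one_pow_dotProduct_eq_zero hw, zero_mul]
  have h4 : ∀ x x' : Fin n → ZMod 2, ∑ y : Fin n → ZMod 2, (-1 : ℂ) ^ (y ⬝ᵥ (w + (x + x'))).val =
      if x' = x + w then 2 ^ n else 0 := by
    intro x x'
    split_ifs with h
    · have : w + (x + x') = 0 := by
        rw [h, show w + (x + (x + w)) = (x + x) + (w + w) by abel,
          add_self_eq_zero_of_zmod_two, add_self_eq_zero_of_zmod_two, add_zero]
      simp [this]
    · refine sum_neg_one_pow_dotProduct_eq_zero fun h0 => h ?_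
      calc x' = (w + (x + x')) + (x + w) - (x + x) - (w + w) := by abel
        _ = x + w := by
          rw [h0, add_self_eq_zero_of_zmod_two, add_self_eq_zero_of_zmod_two]
          simp
  have h5 : ∑ y : Fin n → ZMod 2, (-1 : ℂ) ^ (y ⬝ᵥ w).val *
      ∑ x, ∑ x', g x * (starRingEnd ℂ) (g x') * (-1 : ℂ) ^ (y ⬝ᵥ (x + x')).val =
      2 ^ n * ∑ x, g x * (starRingEnd ℂ) (g (x + w)) := by
    simp only [Finset.mul_sum]
    rw [Finset.sum_comm]
    refine Finset.sum_congr rfl fun x _ => ?_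
    rw [Finset.sum_comm]
    trans ∑ x', g x * (starRingEnd ℂ) (g x') *
      ∑ y : Fin n → ZMod 2, (-1 : ℂ) ^ (y ⬝ᵥ (w + (x + x'))).val
    · refine Finset.sum_congr rfl fun x' _ => ?_
      rw [Finset.mul_sum]
      refine Finset.sum_congr rfl fun y _ => ?_
      rw [dotProduct_add y w, neg_one_pow_val_add]
      ring
    · simp only [h4, mul_ite, mul_zero, Finset.sum_ite_eq', Finset.mem_univ, if_true]
      ring
  rw [h5] at h3
  exact (mul_eq_zero.1 h3).resolve_left (pow_ne_zero _ two_ne_zero)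

/-! ### Two polygons and the contradiction -/

/-- Odd polygons with an even total are even in number. Four or more would be all `a`-gons, giving
`a ∣ 2 ^ n`, or have at least `3 * a + b` vertices. Two of equal size `q` would give `q ∣ 2 ^ n`. -/
theorem IsGonSum.exists_two_gons {a b m n : ℕ} (hm : Odd m) (hn : 1 ≤ n) (hab : a ≤ b)
    (hq : ∀ q : ℕ, q.Prime → q ∣ m → q = a ∨ b ≤ q) {E : Multiset ℂ} (hE : IsGonSum m E)
    (hcard : E.card = 2 ^ n) (hlt : 2 ^ n < 3 * a + b) :
    ∃ g h : ℂ, ∃ q q' : ℕ, g ≠ 0 ∧ h ≠ 0 ∧ q.Prime ∧ q'.Prime ∧ q ∣ m ∧ q' ∣ m ∧ q ≠ q' ∧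
      E = gon g q + gon h q' := by
  obtain ⟨Q, hQ, rfl⟩ := hE
  have hsum : (Q.map fun c => c.2).sum = 2 ^ n := by
    rw [← hcard]
    clear hQ hcard
    induction Q using Multiset.induction with
    | empty => simp
    | cons c Q ih => simp [ih, card_gon]
  have hodd : ∀ c ∈ Q, c.2 % 2 = 1 := fun c hc =>
    Nat.odd_iff.1 (hm.of_dvd_nat (hQ c hc).2.2)
  have hnd : ∀ c ∈ Q, ¬ c.2 ∣ 2 ^ n := by
    intro c hc h
    have := (Nat.prime_dvd_prime_iff_eq (hQ c hc).2.1 Nat.prime_two).1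
      ((hQ c hc).2.1.dvd_of_dvd_pow h)
    have := hodd c hc
    omega
  have hpar : ∀ R ≤ Q, (R.map fun c => c.2).sum % 2 = R.card % 2 := by
    intro R
    induction R using Multiset.induction with
    | empty => simp
    | cons c R ih =>
      intro hR
      have h1 := ih ((Multiset.le_cons_self R c).trans hR)
      have h2 := hodd c (Multiset.mem_of_le hR (Multiset.mem_cons_self c R))
      simp only [Multiset.map_cons, Multiset.sum_cons, Multiset.card_cons]
      omega
  have hcardQ := hpar Q le_rfl
  have h2n : 2 ^ n % 2 = 0 := Nat.mod_eq_zero_of_dvd (dvd_pow_self 2 (by omega))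
  have hpos : 0 < 2 ^ n := by positivity
  rw [hsum, h2n] at hcardQ
  have hQ0 : Q.card ≠ 0 := by
    intro h
    rw [Multiset.card_eq_zero.1 h] at hsum
    simp at hsum
    omega
  rcases Nat.lt_or_ge Q.card 4 with h4 | h4
  · obtain ⟨c, d, rfl⟩ := Multiset.card_eq_two.1 (by omega : Q.card = 2)
    simp only [Multiset.insert_eq_cons, Multiset.mem_cons, Multiset.mem_singleton, forall_eq_or_imp,
      forall_eq, Multiset.map_cons, Multiset.map_singleton, Multiset.sum_cons,
      Multiset.sum_singleton] at hQ hsum hnd ⊢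
    refine ⟨c.1, d.1, c.2, d.2, hQ.1.1, hQ.2.1, hQ.1.2.1, hQ.2.2.1, hQ.1.2.2, hQ.2.2.2, ?_, rfl⟩
    intro h
    exact hnd.1 ⟨2, by omega⟩
  exfalso
  by_cases hall : ∀ c ∈ Q, c.2 = a
  · obtain ⟨c, hc⟩ := Multiset.card_pos_iff_exists_mem.1 (Nat.pos_of_ne_zero hQ0)
    refine hnd c hc ⟨Q.card, ?_⟩
    rw [← hsum, Multiset.map_congr rfl hall, hall c hc]
    simp [mul_comm]
  · push Not at hall
    obtain ⟨c, hc, hca⟩ := hall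
    have hcb := (hq c.2 (hQ c hc).2.1 (hQ c hc).2.2).resolve_left hca
    obtain ⟨R, rfl⟩ := Multiset.exists_cons_of_mem hc
    have h3 : (R.map fun c => c.2).card • a ≤ (R.map fun c => c.2).sum := by
      refine Multiset.card_nsmul_le_sum fun x hx => ?_
      obtain ⟨d, hd, rfl⟩ := Multiset.mem_map.1 hx
      have hd' := hQ d (Multiset.mem_cons_of_mem hd)
      rcases hq d.2 hd'.2.1 hd'.2.2 with h | h
      · exact h.ge
      · exact hab.trans h
    rw [Multiset.card_map, smul_eq_mul] at h3
    simp only [Multiset.map_cons, Multiset.sum_cons, Multiset.card_cons] at hsum h4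
    have h5 : 3 * a ≤ R.card * a := Nat.mul_le_mul_right a (by omega)
    omega

/-- If a vertex of the `q`-gon has its inverse in that polygon, `g ^ q` is its own inverse, hence 1
by odd order. Otherwise the inverses of two adjacent vertices both lie on the `q'`-gon, forcing `q ∣
q'`. -/
theorem pow_eq_one_of_inv_mem {m q q' : ℕ} (hm : Odd m) (hq : q.Prime) (hq' : q'.Prime)
    (hqq : q ≠ q') {g h : ℂ} (hg : g ≠ 0) (hh : h ≠ 0) (hgm : g ^ m = 1)
    (hinv : ∀ z ∈ gon g q + gon h q', z⁻¹ ∈ gon g q + gon h q') : g ^ q = 1 := by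
  have hζ := Complex.isPrimitiveRoot_exp q hq.ne_zero
  set ζ := Complex.exp (2 * Real.pi * Complex.I / q)
  have hζ0 : ζ ≠ 0 := Complex.exp_ne_zero _
  have key : ∀ z : ℂ, z ^ q = g ^ q → g ^ q = 1 ∨ (z⁻¹) ^ q' = h ^ q' := by
    intro z hz
    have h1 := hinv z (Multiset.mem_add.2 (Or.inl ((mem_gon hg hq.pos).2 hz)))
    rw [Multiset.mem_add, mem_gon hg hq.pos, mem_gon hh hq'.pos, inv_pow, hz] at h1
    refine h1.imp_left fun h2 => ?_
    have h3 : (g ^ q) ^ 2 = 1 := by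
      rw [pow_two]
      nth_rewrite 1 [← h2]
      exact inv_mul_cancel₀ (pow_ne_zero _ hg)
    have h4 : (g ^ q) ^ m = 1 := by rw [← pow_mul, mul_comm, pow_mul, hgm, one_pow]
    exact orderOf_eq_one_iff.1 (Nat.eq_one_of_dvd_coprimes hm.coprime_two_left
      (orderOf_dvd_of_pow_eq_one h3) (orderOf_dvd_of_pow_eq_one h4))
  rcases key g rfl with h1 | h1
  · exact h1
  rcases key (g * ζ) (by rw [mul_pow, hζ.pow_eq_one, mul_one]) with h2 | h2
  · exact h2
  exfalso
  rw [← h1, mul_inv, mul_pow] at h2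
  have h3 : ζ ^ q' = 1 := by
    have h4 := mul_left_cancel₀ (pow_ne_zero q' (inv_ne_zero hg)) (h2.trans (mul_one _).symm)
    rwa [inv_pow, inv_eq_one] at h4
  exact hqq ((Nat.prime_dvd_prime_iff_eq hq hq').1 (hζ.dvd_of_pow_eq_one _ h3))

/-- If neither `r` nor `t` is `q`, then `v = (u * v) / u` has order dividing both `q` and `r * t`,
so it is 1. -/
theorem pow_eq_one_of_mul_pow_eq_one {u v : ℂ} {q r t : ℕ} (hq : q.Prime) (hr : r.Prime)
    (ht : t.Prime) (hv : v ^ q = 1) (hv1 : v ≠ 1) (hu : u ^ r = 1) (huv : (u * v) ^ t = 1) :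
    u ^ q = 1 := by
  rcases eq_or_ne r q with rfl | hrq
  · exact hu
  rcases eq_or_ne t q with rfl | htq
  · rwa [mul_pow, hv, mul_one] at huv
  exfalso
  have h1 : v ^ (r * t) = 1 := by
    have h2 : (u * v) ^ (r * t) = 1 := by rw [mul_comm r, pow_mul, huv, one_pow]
    rwa [mul_pow, pow_mul u, hu, one_pow, one_mul] at h2
  have hc : Nat.Coprime q (r * t) :=
    Nat.Coprime.mul_right ((Nat.coprime_primes hq hr).2 hrq.symm)
      ((Nat.coprime_primes hq ht).2 htq.symm)
  exact hv1 (orderOf_eq_one_iff.1 (Nat.eq_one_of_dvd_coprimes hc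
    (orderOf_dvd_of_pow_eq_one hv) (orderOf_dvd_of_pow_eq_one h1)))

theorem three_mul_add_le_of_isGeneralizedBent {a b m n : ℕ} (hm : Odd m) (hn : 1 ≤ n) (ha : 3 ≤ a)
    (hab : a + 2 ≤ b) (hq : ∀ q : ℕ, q.Prime → q ∣ m → q = a ∨ b ≤ q)
    {f : (Fin n → ZMod 2) → ZMod m} (hf : IsGeneralizedBent m n f) : 3 * a + b ≤ 2 ^ n := by
  by_contra! hlt
  have hζ := Complex.isPrimitiveRoot_exp m hm.pos.ne'
  set ζ := Complex.exp (2 * Real.pi * Complex.I / m) with hζdef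
  set g : (Fin n → ZMod 2) → ℂ := fun x => ζ ^ (f x).val with hgdef
  have hgm : ∀ x, g x ^ m = 1 := fun x => by
    rw [hgdef]
    simp only
    rw [← pow_mul, mul_comm, pow_mul, hζ.pow_eq_one, one_pow]
  have hg0 : ∀ x, g x ≠ 0 := fun x => pow_ne_zero _ (Complex.exp_ne_zero _)
  have hconj : ∀ x, (starRingEnd ℂ) (g x) = (g x)⁻¹ := fun x =>
    (Complex.inv_eq_conj (Complex.norm_eq_one_of_pow_eq_one (hgm x) hm.pos.ne')).symm
  have hdm : ∀ x x', (g x / g x') ^ m = 1 := fun x x' => by rw [div_pow, hgm, hgm, div_one]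
  have main : ∀ w : Fin n → ZMod 2, w ≠ 0 → ∃ q q' : ℕ, q.Prime ∧ q'.Prime ∧ q ≠ q' ∧
      (∀ x, (g x / g (x + w)) ^ q = 1 ∨ (g x / g (x + w)) ^ q' = 1) ∧
      (∃ x, (g x / g (x + w)) ^ q = 1 ∧ g x / g (x + w) ≠ 1) ∧
      (∃ x, (g x / g (x + w)) ^ q' = 1 ∧ g x / g (x + w) ≠ 1) := by
    intro w hw
    set E : Multiset ℂ := Finset.univ.val.map fun x => g x / g (x + w) with hEdef
    have hmemE : ∀ z, z ∈ E ↔ ∃ x, g x / g (x + w) = z := fun z => by simp [hEdef]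
    have hE0 : E.sum = 0 := by
      have := autocorrelation_eq_zero g hf hw
      simp only [hconj, ← div_eq_mul_inv] at this
      exact this
    have hEc : E.card = 2 ^ n := by simp [hEdef, ZMod.card]
    have hEm : ∀ z ∈ E, z ^ m = 1 := fun z hz => by
      obtain ⟨x, rfl⟩ := (hmemE z).1 hz
      exact hdm _ _
    have hEinv : ∀ z ∈ E, z⁻¹ ∈ E := fun z hz => by
      obtain ⟨x, rfl⟩ := (hmemE z).1 hz
      refine (hmemE _).2 ⟨x + w, ?_⟩
      rw [add_assoc, add_self_eq_zero_of_zmod_two, add_zero, inv_div]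
    obtain ⟨c, d, q, q', hc, hd, hqp, hqp', hqm, hqm', hqq, hE⟩ :=
      (isGonSum_of_sum_eq_zero ha hab m hm hq E hEm hE0 (by rwa [hEc])).exists_two_gons
        hm hn (by omega) hq hEc hlt
    have hcE : c ∈ E := by
      rw [hE]
      exact Multiset.mem_add.2 (Or.inl ((mem_gon hc hqp.pos).2 rfl))
    have hdE : d ∈ E := by
      rw [hE]
      exact Multiset.mem_add.2 (Or.inr ((mem_gon hd hqp'.pos).2 rfl))
    have hcq : c ^ q = 1 := pow_eq_one_of_inv_mem hm hqp hqp' hqq hc hd (hEm c hcE) (hE ▸ hEinv)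
    have hdq : d ^ q' = 1 := pow_eq_one_of_inv_mem hm hqp' hqp hqq.symm hd hc (hEm d hdE)
      (add_comm (gon c q) _ ▸ hE ▸ hEinv)
    have hiff : ∀ z, z ∈ E ↔ z ^ q = 1 ∨ z ^ q' = 1 := fun z => by
      rw [hE, Multiset.mem_add, mem_gon hc hqp.pos, mem_gon hd hqp'.pos, hcq, hdq]
    have hex : ∀ l : ℕ, l.Prime → (∀ z : ℂ, z ^ l = 1 → z ∈ E) →
        ∃ x, (g x / g (x + w)) ^ l = 1 ∧ g x / g (x + w) ≠ 1 := by
      intro l hl h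
      have hρ := Complex.isPrimitiveRoot_exp l hl.ne_zero
      obtain ⟨x, hx⟩ := (hmemE _).1 (h _ hρ.pow_eq_one)
      exact ⟨x, by rw [hx]; exact hρ.pow_eq_one, by rw [hx]; exact hρ.ne_one hl.one_lt⟩
    exact ⟨q, q', hqp, hqp', hqq, fun x => (hiff _).1 ((hmemE _).2 ⟨x, rfl⟩),
      hex q hqp fun z hz => (hiff z).2 (Or.inl hz),
      hex q' hqp' fun z hz => (hiff z).2 (Or.inr hz)⟩
  have hprime : ∀ x x', ∃ r : ℕ, r.Prime ∧ (g x / g x') ^ r = 1 := by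
    intro x x'
    rcases eq_or_ne x x' with rfl | hne
    · exact ⟨2, Nat.prime_two, by rw [div_self (hg0 x), one_pow]⟩
    have hx' : x + (x + x') = x' := by
      rw [← add_assoc, add_self_eq_zero_of_zmod_two, zero_add]
    obtain ⟨q, q', hqp, hqp', -, h, -, -⟩ := main (x + x') fun h0 => hne (by
      rw [h0, add_zero] at hx'
      exact hx')
    have := h x
    rw [hx'] at this
    exact this.elim (fun h => ⟨q, hqp, h⟩) fun h => ⟨q', hqp', h⟩
  -- Any nonzero shift would do; the all-ones vector is nonzero because `1 ≤ n`.
  obtain ⟨q, q', hqp, hqp', hqq, -, ⟨x, hx, hx1⟩, ⟨y, hy, hy1⟩⟩ :=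
    main (fun _ => 1) fun h => one_ne_zero (congrFun h ⟨0, hn⟩)
  set x' := x + fun _ => 1
  set y' := y + fun _ => 1
  -- Both `g t / g x` and `g t / g x'` are killed by primes, and they differ by the factor `g x / g
  -- x'` of order `q`.
  have key : ∀ t, (g t / g x) ^ q = 1 := by
    intro t
    obtain ⟨r, hr, h1⟩ := hprime t x
    obtain ⟨s, hs, h2⟩ := hprime t x'
    refine pow_eq_one_of_mul_pow_eq_one hqp hr hs hx hx1 h1 ?_
    rwa [div_mul_div_cancel₀ (hg0 x)]
  have h3 : (g y / g y') ^ q = 1 := by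
    rw [← div_div_div_cancel_right₀ (hg0 x), div_pow, key, key, div_one]
  exact hy1 (orderOf_eq_one_iff.1 (Nat.eq_one_of_dvd_coprimes
    ((Nat.coprime_primes hqp hqp').2 hqq) (orderOf_dvd_of_pow_eq_one h3)
    (orderOf_dvd_of_pow_eq_one hy)))

theorem theorem3p4 (m n s : ℕ) (p α : Fin s → ℕ) (hn : 1 ≤ n)
    (hprime : ∀ i, (p i).Prime) (hodd : ∀ i, 3 ≤ p i) (hmono : StrictMono p)
    (hα : ∀ i, 1 ≤ α i) (hm : m = ∏ i, p i ^ α i)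
    (hf : ∃ f : (Fin n → ZMod 2) → ZMod m, IsGeneralizedBent m n f) :
    ∃ hs : 2 ≤ s, 3 * p ⟨0, by omega⟩ + p ⟨1, by omega⟩ ≤ 2 ^ n := by
  obtain ⟨f, hf⟩ := hf
  have hpodd : ∀ i, Odd (p i) := fun i =>
    (hprime i).odd_of_ne_two (by have := hodd i; omega)
  have hmodd : Odd m := by
    rw [hm]
    exact Finset.prod_induction _ Odd (fun _ _ => Odd.mul) odd_one fun i _ => (hpodd i).pow
  have hdvd : ∀ q : ℕ, q.Prime → q ∣ m → ∃ i, q = p i := by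
    intro q hq hqm
    rw [hm] at hqm
    obtain ⟨i, -, hi⟩ := (Prime.dvd_finsetProd_iff hq.prime _).1 hqm
    exact ⟨i, (Nat.prime_dvd_prime_iff_eq hq (hprime i)).1 (hq.dvd_of_dvd_pow hi)⟩
  have hs : 2 ≤ s := by
    by_contra! hs
    obtain ⟨a, ha3, ha⟩ : ∃ a, 3 ≤ a ∧ ∀ i, p i = a := by
      rcases Nat.eq_zero_or_pos s with rfl | h0
      · exact ⟨3, le_rfl, fun i => i.elim0⟩
      · exact ⟨p ⟨0, h0⟩, hodd _, fun i => congrArg p (Fin.ext (by have := i.2; omega))⟩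
    -- With at most one prime the second parameter is unconstrained, and a value above `2 ^ n` is
    -- absurd.
    have := three_mul_add_le_of_isGeneralizedBent (b := a + 2 + 2 ^ n) hmodd hn ha3
      (Nat.le_add_right _ _)
      (fun q h1 h2 => Or.inl (by obtain ⟨i, rfl⟩ := hdvd q h1 h2; exact ha i)) hf
    have := Nat.two_pow_pos n
    omega
  refine ⟨hs, three_mul_add_le_of_isGeneralizedBent hmodd hn (hodd _) ?_ ?_ hf⟩
  · have h01 : p ⟨0, by omega⟩ < p ⟨1, by omega⟩ := hmono (by simp [Fin.lt_def])
    obtain ⟨i, hi⟩ := hpodd ⟨0, by omega⟩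
    obtain ⟨j, hj⟩ := hpodd ⟨1, by omega⟩
    omega
  · intro q h1 h2
    obtain ⟨i, rfl⟩ := hdvd q h1 h2
    rcases Nat.eq_zero_or_pos i.1 with h0 | h0
    · exact Or.inl (congrArg p (Fin.ext h0))
    · exact Or.inr (hmono.monotone (Fin.le_def.2 h0))
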